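/- **Theorem (Consistency, case $s=1$).** Let $T>0$, let $a,b\in L^\infty(0,1)$ be non-negative and let $q\in L^\infty(0,1)$ be real. Write $\mathcal L_q=-\frac{d^2}{dx^2}+q$ for the Sturm–Liouville operator in $L^2(0,1)$ (complex-valued functions) with domain $\{f\in L^2: f''\in L^2,\ f(0)=f(1)=0\}$; powers $\mathcal L_q^{s}$ are defined by $\mathcal L_q^{s}\phi=\lambda^{s}\phi$ on the eigenfunctions $\mathcal L_q\phi=\lambda\phi$ (principal power if $\lambda<0$), and $W^1_{\mathcal L_q}=\{f\in L^2:\mathcal L_q^{1/2}f\in L^2\}$ carries the (semi)norm $\|\mathcal L_q^{1/2}f\|_{L^2}$. By a solution of $$u_{tt}+\mathcal L_q u+a\,u+b\,u_t=0 \text{ on } [0,T]\times(0,1),\quad u(0,\cdot)=u_0,\ u_t(0,\cdot)=u_1,\quad u(t,0)=u(t,1)=0 \qquad (P_{q,a,b,u_0,u_1})$$ we mean a function $u\in C([0,T];W^1_{\mathcal L_q})\cap C^1([0,T];L^2(0,1))$ which satisfies the initial and boundary conditions, and satisfies the equation in the sense that $\frac{d}{dt}\langle u_t,\phi\rangle=-\langle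 u,\mathcal L_q\phi\rangle-\langle au+bu_t,\phi\rangle$ on $[0,T]$ for every $\phi$ in the domain of $\mathcal L_q$. Let $u_0\in L^2(0,1)$ with $u_0''\in L^2(0,1)$ and $u_1\in L^2(0,1)$ be such that a solution $u$ (the classical solution) of $(P_{q,a,b,u_0,u_1})$ exists. Let $(a_\varepsilon),(b_\varepsilon),(q_\varepsilon)$, $\varepsilon\in(0,1]$, be nets of real functions in $L^\infty(0,1)$ and let $(u_{0,\varepsilon}),(u_{1,\varepsilon})$ be nets in $L^2(0,1)$ with $$\|a_\varepsilon-a\|_{L^\infty}\to0,\quad \|b_\varepsilon-b\|_{L^\infty}\to0,\quad \|q_\varepsilon-q\|_{L^\infty}\to0,\quad \|u_{0,\varepsilon}-u_0\|_{L^2}\to0,\quad \|u_{1,\varepsilon}-u_1\|_{L^2}\to0\qquad(\varepsilon\to0).$$ Let the net $(u_\varepsilon)_{\varepsilon\in(0,1]}$ be the very weak solution that belongs to these nets, that is: * $a_\varepsilon,b_\varepsilon\ge0$ for all $\varepsilon\in(0,1]$; * for some $N\in\mathbb N_0$ and $C$, each of $\|a_\varepsilon\|_{L^\infty}$, $\|b_\varepsilon\|_{L^\infty}$,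 $\|q_\varepsilon\|_{L^\infty}$, $\|u_{0,\varepsilon}\|_{L^2}+\|u_{0,\varepsilon}''\|_{L^2}$ and $\|u_{1,\varepsilon}\|_{L^2}$ is at most $C\varepsilon^{-N}$ for all $\varepsilon\in(0,1]$; * for every $\varepsilon\in(0,1]$, $u_\varepsilon$ is a solution of $(P_{q_\varepsilon,a_\varepsilon,b_\varepsilon,u_{0,\varepsilon},u_{1,\varepsilon}})$; * for some $N\in\mathbb N_0$ and $C$, $\sup_{t\in[0,T]}\big(\|u_\varepsilon(t,\cdot)\|_{L^2}+\|\mathcal L_{q_\varepsilon}^{1/2}u_\varepsilon(t,\cdot)\|_{L^2}+\|\partial_tu_\varepsilon(t,\cdot)\|_{L^2}\big)\le C\varepsilon^{-N}$ for all $\varepsilon\in(0,1]$. Then $u_\varepsilon\to u$ in $L^2(0,1)$ uniformly in $t$: $$\sup_{t\in[0,T]}\|u_\varepsilon(t,\cdot)-u(t,\cdot)\|_{L^2(0,1)}\to0\qquad(\varepsilon\to0).$$ -/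

import Mathlib

open MeasureTheory Set Filter Topology
open scoped ENNReal ContDiff

namespace SturmLiouvilleWave

/-- Lebesgue measure on the open unit interval. -/
noncomputable abbrev unitMeasure : Measure ℝ := volume.restrict (Ioo (0 : ℝ) 1)

/-- The complex Hilbert space `L²(0,1)`. -/
abbrev L2 : Type := Lp ℂ 2 unitMeasure

/-- The space `L^∞(0,1)` of real-valued functions; it acts on `L²(0,1)` by multiplication,
`q • f` being the pointwise product. -/
abbrev Linf : Type := Lp ℝ ∞ unitMeasure

/-- `g = f''` on `(0,1)` in the sense of distributions. -/
def IsWeakSecondDeriv (f g : L2) : Prop :=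
  ∀ φ : ℝ → ℂ, ContDiff ℝ ∞ φ → HasCompactSupport φ → tsupport φ ⊆ Ioo (0 : ℝ) 1 →
    ∫ x in Ioo (0 : ℝ) 1, f x * deriv (deriv φ) x = ∫ x in Ioo (0 : ℝ) 1, g x * φ x

/-- `f(0) = f(1) = 0`: the class `f` has a representative that is continuous on `[0,1]` and
vanishes at both end points (a continuous representative on `[0,1]` is unique). -/
def VanishesAtBoundary (f : L2) : Prop :=
  ∃ F : ℝ → ℂ, ContinuousOn F (Icc 0 1) ∧ F =ᵐ[unitMeasure] f ∧ F 0 = 0 ∧ F 1 = 0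

/-- The graph of the Dirichlet Sturm-Liouville operator `𝓛 = -d²/dx² + q` in `L²(0,1)`: `f` lies
in the domain (`f, f'' ∈ L²` and `f(0) = f(1) = 0`) and `𝓛 f = g`. -/
def SLGraph (q : Linf) (f g : L2) : Prop :=
  VanishesAtBoundary f ∧ ∃ f₂ : L2, IsWeakSecondDeriv f f₂ ∧ g = -f₂ + q • f

/-- The graph of the fractional power `𝓛^s`, the operator which multiplies the coefficient along
every eigenfunction `φ` of `𝓛` by `lam ^ s`, where `lam` is the eigenvalue of `φ`: here `f` and
`𝓛^s f = g` are both in `L²`. (For `s > 0` and a negative eigenvalue, of which there are finitely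
many, the principal complex power is used, so that `|lam ^ s| = |lam| ^ s`.) -/
def SLPowGraph (q : Linf) (s : ℝ) (f g : L2) : Prop :=
  ∀ (lam : ℝ) (φ : L2), SLGraph q φ ((lam : ℂ) • φ) →
    inner ℂ φ g = (lam : ℂ) ^ (s : ℂ) * inner ℂ φ f

/-- `u ∈ C([0,T]; W¹_𝓛) ∩ C¹([0,T]; L²)`, with time derivative `v = u_t` and `w = 𝓛^{1/2} u`.
The space `W¹_𝓛` consists of the `f` with `𝓛^{1/2} f ∈ L²` and has the norm `‖𝓛^{1/2} f‖`. -/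
structure InSolutionSpace (T : ℝ) (q : Linf) (u v w : ℝ → L2) : Prop where
  hasDeriv : ∀ t ∈ Icc 0 T, HasDerivWithinAt u (v t) (Icc 0 T) t
  continuousOn_deriv : ContinuousOn v (Icc 0 T)
  sqrt_graph : ∀ t ∈ Icc 0 T, SLPowGraph q (1 / 2) (u t) (w t)
  continuousOn_sqrt : ContinuousOn w (Icc 0 T)

/-- `u ∈ C([0,T]; W¹_𝓛) ∩ C¹([0,T]; L²)` is a solution of the initial/boundary value problem
`u_tt + 𝓛 u + a u + b u_t = 0`, `u(0) = u₀`, `u_t(0) = u₁`, `u(t,0) = u(t,1) = 0`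
on `[0,T] × (0,1)`. The equation is tested against every `φ` in the domain of `𝓛`
(`ψ = 𝓛 φ`):
`d/dt ⟨φ, u_t⟩ = - ⟨𝓛 φ, u⟩ - ⟨φ, a u + b u_t⟩`. -/
def IsSolution (T : ℝ) (q a b : Linf) (u₀ u₁ : L2) (u : ℝ → L2) : Prop :=
  ∃ v w : ℝ → L2, InSolutionSpace T q u v w ∧
    u 0 = u₀ ∧ v 0 = u₁ ∧
    (∀ t ∈ Icc 0 T, VanishesAtBoundary (u t)) ∧
    ∀ φ ψ : L2, SLGraph q φ ψ → ∀ t ∈ Icc 0 T,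
      HasDerivWithinAt (fun τ => inner ℂ φ (v τ))
        (-(inner ℂ ψ (u t)) - inner ℂ φ (a • u t + b • v t)) (Icc 0 T) t

/-- A net `(f_ε)`, `ε ∈ (0,1]`, in a normed space is moderate: `‖f_ε‖ ≤ C ε^{-N}`. -/
def IsModerate {X : Type*} [NormedAddCommGroup X] (f : ℝ → X) : Prop :=
  ∃ (N : ℕ) (C : ℝ), ∀ ε ∈ Ioc (0 : ℝ) 1, ‖f ε‖ ≤ C * (ε ^ N)⁻¹

/-- A net in `L²(0,1)` is `H²`-moderate: `‖f_ε‖ + ‖f_ε''‖ ≤ C ε^{-N}`. -/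
def IsH2Moderate (f : ℝ → L2) : Prop :=
  ∃ (N : ℕ) (C : ℝ), ∀ ε ∈ Ioc (0 : ℝ) 1, ∃ g : L2,
    IsWeakSecondDeriv (f ε) g ∧ ‖f ε‖ + ‖g‖ ≤ C * (ε ^ N)⁻¹

/-- A net `(u_ε)` with `u_ε ∈ C([0,T]; W¹) ∩ C¹([0,T]; L²)` is uniformly `1`-moderate:
`sup_t (‖u_ε(t)‖ + ‖𝓛^{1/2} u_ε(t)‖ + ‖∂_t u_ε(t)‖) ≤ C ε^{-N}`, where `𝓛` is the operator of
the `ε`-dependent problem, that is, the one with potential `q_ε`. -/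
def IsUniformlyModerate (T : ℝ) (q : ℝ → Linf) (u : ℝ → ℝ → L2) : Prop :=
  ∃ (N : ℕ) (C : ℝ), ∀ ε ∈ Ioc (0 : ℝ) 1, ∃ v w : ℝ → L2,
    InSolutionSpace T (q ε) (u ε) v w ∧
      ∀ t ∈ Icc 0 T, ‖u ε t‖ + ‖w t‖ + ‖v t‖ ≤ C * (ε ^ N)⁻¹

/-- The net `(u_ε)`, `ε ∈ (0,1]`, is the very weak solution that belongs to the nets of
coefficients `a_ε, b_ε, q_ε` and of data `u_{0,ε}, u_{1,ε}`. -/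
structure IsVeryWeakSolution (T : ℝ) (q a b : ℝ → Linf) (u₀ u₁ : ℝ → L2)
    (u : ℝ → ℝ → L2) : Prop where
  nonneg_a : ∀ ε ∈ Ioc (0 : ℝ) 1, 0 ≤ a ε
  nonneg_b : ∀ ε ∈ Ioc (0 : ℝ) 1, 0 ≤ b ε
  moderate_a : IsModerate a
  moderate_b : IsModerate b
  moderate_q : IsModerate q
  moderate_u₀ : IsH2Moderate u₀
  moderate_u₁ : IsModerate u₁
  solves : ∀ ε ∈ Ioc (0 : ℝ) 1, IsSolution T (q ε) (a ε) (b ε) (u₀ ε) (u₁ ε) (u ε)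
  moderate : IsUniformlyModerate T q u

end SturmLiouvilleWave

/-!
The data converge in `L²` only, so no energy estimate is available for `u_ε - u` itself. Integrating
the equation once in time moves it one derivative down: `U = ∫₀ᵗ u` satisfies
`-U'' = u₁ - u_t - (q + a) U - b (u - u₀)`, so `U = G (u₁ - u_t - (q + a) U - b (u - u₀))` for the
Green operator `G` of the Dirichlet Laplacian. Here `G = A A†`, where `A f` is the primitive of
`f - ∫₀¹ f` vanishing at both end points; thus `G` is positive.
If `G h` is the difference of the two primitives, then `d = u_ε - u` is the time derivative of
`G h`, and `‖d‖² + ⟨h, G h⟩ + ‖G h‖²` obeys a Gronwall inequality whose forcing term tends to `0`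
with the perturbation of the coefficients and of the data.
-/

namespace SturmLiouvilleWave

section Energy

variable {𝕜 E : Type*} [RCLike 𝕜] [NormedAddCommGroup E] [InnerProductSpace 𝕜 E]

/-- The energy of a state with velocity `d` and displacement `S h`, where `S` is the inverse of the
elliptic operator. The term `‖S h‖²` is no part of the physical energy; it absorbs perturbations of
order zero. -/
noncomputable def waveEnergy (S : E →L[𝕜] E) (h d : E) : ℝ :=
  ‖d‖ ^ 2 + S.reApplyInnerSelf h + ‖S h‖ ^ 2

lemma norm_sq_le_waveEnergy {S : E →L[𝕜] E} (hS : S.IsPositive) (h d : E) :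
    ‖d‖ ^ 2 ≤ waveEnergy S h d := by
  have := hS.2 h
  unfold waveEnergy
  linarith [sq_nonneg ‖S h‖]

lemma two_mul_re_inner_le_waveEnergy {S : E →L[𝕜] E} (hS : S.IsPositive) {h d e : E} {M g : ℝ}
    (hM : 0 ≤ M) (he : ‖e + h‖ ≤ g + M * (‖S h‖ + ‖d‖)) :
    2 * RCLike.re (inner 𝕜 d (e + h + S h)) ≤ (3 * M + 2) * waveEnergy S h d + g ^ 2 := by
  have hpos : 0 ≤ (3 * M + 2) * S.reApplyInnerSelf h := mul_nonneg (by positivity) (hS.2 h)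
  calc 2 * RCLike.re (inner 𝕜 d (e + h + S h))
      ≤ 2 * (‖d‖ * ‖e + h + S h‖) := by gcongr; exact re_inner_le_norm _ _
    _ ≤ 2 * (‖d‖ * (g + M * (‖S h‖ + ‖d‖) + ‖S h‖)) := by
        gcongr
        exact (norm_add_le _ _).trans (by gcongr)
    _ ≤ (3 * M + 2) * (‖d‖ ^ 2 + ‖S h‖ ^ 2) + g ^ 2 := by
        nlinarith [mul_nonneg hM (sq_nonneg (‖d‖ - ‖S h‖)), mul_nonneg hM (sq_nonneg ‖S h‖),
          sq_nonneg (‖d‖ - g), sq_nonneg (‖d‖ - ‖S h‖), sq_nonneg ‖S h‖]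
    _ ≤ (3 * M + 2) * waveEnergy S h d + g ^ 2 := by
        unfold waveEnergy
        linarith

variable [NormedSpace ℝ E]

lemma hasDerivWithinAt_norm_sq {f : ℝ → E} {f' : E} {s : Set ℝ} {t : ℝ}
    (hf : HasDerivWithinAt f f' s t) :
    HasDerivWithinAt (fun τ => ‖f τ‖ ^ 2) (2 * RCLike.re (inner 𝕜 (f t) f')) s t := by
  have hre := (RCLike.reCLM (K := 𝕜)).hasFDerivAt.comp_hasDerivWithinAt t (hf.inner 𝕜 hf)
  simp only [Function.comp_def, RCLike.reCLM_apply, inner_self_eq_norm_sq] at hre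
  refine hre.congr_deriv ?_
  rw [map_add, inner_re_symm f', two_mul]

lemma hasDerivWithinAt_reApplyInnerSelf {S : E →L[𝕜] E} (hS : S.IsSymmetric) {h : ℝ → E} {d : E}
    {s : Set ℝ} {t : ℝ} (hh : ContinuousWithinAt h s t)
    (hd : HasDerivWithinAt (fun τ => S (h τ)) d s t) :
    HasDerivWithinAt (fun τ => S.reApplyInnerSelf (h τ)) (2 * RCLike.re (inner 𝕜 d (h t))) s t := by
  rw [hasDerivWithinAt_iff_tendsto_slope] at hd ⊢
  have hsum : Tendsto (fun τ => h τ + h t) (𝓝[s \ {t}] t) (𝓝 (h t + h t)) :=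
    (hh.mono sdiff_subset).add_const _
  have hlim := (RCLike.continuous_re.tendsto _).comp (hd.inner (𝕜 := 𝕜) hsum)
  rw [inner_add_right, map_add, ← two_mul] at hlim
  refine hlim.congr fun τ => ?_
  have hswap : RCLike.re (inner 𝕜 (S (h τ)) (h t)) = RCLike.re (inner 𝕜 (S (h t)) (h τ)) := by
    rw [hS.apply_clm, inner_re_symm]
  rw [Function.comp_apply, slope_def_module, slope_def_module, inner_smul_left_eq_smul,
    RCLike.smul_re, smul_eq_mul, inner_add_right, inner_sub_left, inner_sub_left]
  simp only [map_add, map_sub, hswap, ContinuousLinearMap.reApplyInnerSelf_apply]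
  ring

lemma hasDerivWithinAt_waveEnergy {S : E →L[𝕜] E} (hS : S.IsSymmetric) {h d : ℝ → E} {e : E}
    {s : Set ℝ} {t : ℝ} (hh : ContinuousWithinAt h s t)
    (hD : HasDerivWithinAt (fun τ => S (h τ)) (d t) s t) (hd : HasDerivWithinAt d e s t) :
    HasDerivWithinAt (fun τ => waveEnergy S (h τ) (d τ))
      (2 * RCLike.re (inner 𝕜 (d t) (e + h t + S (h t)))) s t := by
  refine (((hasDerivWithinAt_norm_sq (𝕜 := 𝕜) hd).add
    (hasDerivWithinAt_reApplyInnerSelf hS hh hD)).add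
    (hasDerivWithinAt_norm_sq (𝕜 := 𝕜) hD)).congr_deriv ?_
  rw [inner_add_right, inner_add_right, map_add, map_add, inner_re_symm (S (h t))]
  ring

theorem norm_sq_le_gronwallBound {S : E →L[𝕜] E} (hS : S.IsPositive) {h d e : ℝ → E}
    {a b M g : ℝ} (hM : 0 ≤ M) (hh : ContinuousOn h (Icc a b))
    (hD : ∀ t ∈ Icc a b, HasDerivWithinAt (fun τ => S (h τ)) (d t) (Icc a b) t)
    (hd : ∀ t ∈ Icc a b, HasDerivWithinAt d (e t) (Icc a b) t) (ha : S (h a) = 0)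
    (he : ∀ t ∈ Icc a b, ‖e t + h t‖ ≤ g + M * (‖S (h t)‖ + ‖d t‖)) {t : ℝ} (ht : t ∈ Icc a b) :
    ‖d t‖ ^ 2 ≤ gronwallBound (‖d a‖ ^ 2) (3 * M + 2) (g ^ 2) (t - a) := by
  have hderiv : ∀ t ∈ Icc a b, HasDerivWithinAt (fun τ => waveEnergy S (h τ) (d τ)) _ (Icc a b) t :=
    fun t ht => hasDerivWithinAt_waveEnergy hS.1 (hh t ht) (hD t ht) (hd t ht)
  refine (norm_sq_le_waveEnergy hS (h t) (d t)).trans ?_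
  refine le_gronwallBound_of_liminf_deriv_right_le
    (fun t ht => (hderiv t ht).continuousWithinAt)
    (fun t ht r hr => ((hderiv t (Ico_subset_Icc_self ht)).mono_of_mem_nhdsWithin
      (Icc_mem_nhdsGE_of_mem ht)).liminf_right_slope_le hr)
    ?_ (fun t ht => two_mul_re_inner_le_waveEnergy hS hM (he t (Ico_subset_Icc_self ht))) t ht
  simp [waveEnergy, ha, ContinuousLinearMap.reApplyInnerSelf_apply]

end Energy

section Multiplication

variable {α 𝕜 F : Type*} {m : MeasurableSpace α} {μ : Measure α} {p r s : ℝ≥0∞}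
  [p.HolderTriple r s] [NormedRing 𝕜] [NormedAddCommGroup F] [Module 𝕜 F] [IsBoundedSMul 𝕜 F]

lemma norm_smul_sub_smul_le [Fact (1 ≤ s)] (k k' : Lp 𝕜 p μ) (f f' : Lp F r μ) :
    ‖(k' • f' - k • f : Lp F s μ)‖ ≤ ‖k'‖ * ‖f' - f‖ + ‖k' - k‖ * ‖f‖ := by
  have hsplit : (k' • f' - k • f : Lp F s μ) = k' • (f' - f) + (k' - k) • f := by
    simp only [sub_eq_add_neg, Lp.smul_add, Lp.add_smul, Lp.neg_smul, Lp.smul_neg]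
    abel
  rw [hsplit]
  exact (norm_add_le _ _).trans (add_le_add (Lp.norm_smul_le _ _) (Lp.norm_smul_le _ _))

end Multiplication

lemma inner_smul_comm (q : Linf) (f g : L2) :
    (inner ℂ f (q • g : L2) : ℂ) = inner ℂ (q • f : L2) g := by
  rw [L2.inner_def, L2.inner_def]
  refine integral_congr_ae ?_
  filter_upwards [Lp.coeFn_lpSMul (r := 2) q f, Lp.coeFn_lpSMul (r := 2) q g] with x hf hg
  rw [hf, hg, Pi.smul_apply', Pi.smul_apply', inner_smul_left_eq_smul, inner_smul_right_eq_smul]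

lemma continuous_Linf_smul (q : Linf) : Continuous fun f : L2 => (q • f : L2) :=
  ((ContinuousLinearMap.lsmul ℝ ℝ).holderL unitMeasure ∞ 2 2 q).continuous

lemma hasDerivWithinAt_Linf_smul (q : Linf) {f : ℝ → L2} {f' : L2} {s : Set ℝ} {t : ℝ}
    (hf : HasDerivWithinAt f f' s t) :
    HasDerivWithinAt (fun τ => (q • f τ : L2)) (q • f' : L2) s t :=
  ((ContinuousLinearMap.lsmul ℝ ℝ).holderL unitMeasure ∞ 2 2 q).hasFDerivAt.comp_hasDerivWithinAt
    t hf

section SetIntegral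

lemma setIntegral_Iic_unitMeasure {F : Type*} [NormedAddCommGroup F] [NormedSpace ℝ F]
    {x : ℝ} (hx : x ∈ Icc 0 1) (f : ℝ → F) :
    ∫ s in Iic x, f s ∂unitMeasure = ∫ s in 0..x, f s := by
  rw [Measure.restrict_restrict measurableSet_Iic, intervalIntegral.integral_of_le hx.1]
  have hset : Ioc 0 x = Iic x ∩ Ioc 0 1 := by
    rw [Iic_inter_Ioc_of_le hx.2]
  rw [hset]
  exact setIntegral_congr_set ((ae_eq_refl _).inter Ioo_ae_eq_Ioc)

lemma setIntegral_Ici_unitMeasure {F : Type*} [NormedAddCommGroup F] [NormedSpace ℝ F]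
    {x : ℝ} (hx : x ∈ Icc 0 1) (f : ℝ → F) :
    ∫ s in Ici x, f s ∂unitMeasure = ∫ s in x..1, f s := by
  rw [Measure.restrict_restrict measurableSet_Ici, intervalIntegral.integral_of_le hx.2,
    ← integral_Icc_eq_integral_Ioc]
  have hset : Icc x 1 = Ici x ∩ Icc 0 1 := by
    rw [← Ici_inter_Iic, ← Ici_inter_Iic, ← inter_assoc, Ici_inter_Ici, sup_eq_left.mpr hx.1]
  rw [hset]
  exact setIntegral_congr_set ((ae_eq_refl _).inter Ioo_ae_eq_Icc)

lemma integral_unitMeasure {F : Type*} [NormedAddCommGroup F] [NormedSpace ℝ F] (f : ℝ → F) :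
    ∫ s, f s ∂unitMeasure = ∫ s in 0..1, f s := by
  rw [intervalIntegral.integral_of_le zero_le_one, integral_Ioc_eq_integral_Ioo]

lemma integral_setIntegral_Iic_mul {α 𝕜 : Type*} [LinearOrder α] [TopologicalSpace α]
    [OrderClosedTopology α] [SecondCountableTopology α] [MeasurableSpace α] [BorelSpace α]
    [RCLike 𝕜] {μ : Measure α} [SFinite μ] {f g : α → 𝕜} (hf : Integrable f μ)
    (hg : Integrable g μ) :
    ∫ x, (∫ s in Iic x, f s ∂μ) * g x ∂μ = ∫ s, f s * (∫ x in Ici s, g x ∂μ) ∂μ := by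
  have hint : Integrable (indicator {z : α × α | z.2 ≤ z.1} fun z => f z.2 * g z.1) (μ.prod μ) := by
    refine Integrable.indicator ?_ (measurableSet_le measurable_snd measurable_fst)
    simpa only [mul_comm] using hg.mul_prod hf
  calc ∫ x, (∫ s in Iic x, f s ∂μ) * g x ∂μ
      = ∫ x, ∫ s, indicator {z : α × α | z.2 ≤ z.1} (fun z => f z.2 * g z.1) (x, s) ∂μ ∂μ := by
        refine integral_congr_ae (.of_forall fun x => ?_)
        dsimp only
        rw [← integral_mul_const, ← integral_indicator measurableSet_Iic]
        rfl
    _ = ∫ s, ∫ x, indicator {z : α × α | z.2 ≤ z.1} (fun z => f z.2 * g z.1) (x, s) ∂μ ∂μ :=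
        integral_integral_swap hint
    _ = ∫ s, f s * (∫ x in Ici s, g x ∂μ) ∂μ := by
        refine integral_congr_ae (.of_forall fun s => ?_)
        dsimp only
        rw [← integral_const_mul, ← integral_indicator measurableSet_Ici]
        rfl

end SetIntegral

instance : IsProbabilityMeasure unitMeasure := ⟨by simp⟩

lemma integrable_L2 (f : L2) : Integrable f unitMeasure :=
  (Lp.memLp f).integrable one_le_two

lemma memLp_unitMeasure {F : Type*} [NormedAddCommGroup F] {f : ℝ → F}
    (hf : ContinuousOn f (Icc 0 1)) (p : ℝ≥0∞) : MemLp f p unitMeasure := by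
  obtain ⟨C, hC⟩ := isCompact_Icc.exists_bound_of_continuousOn hf
  refine .of_bound ((hf.mono Ioo_subset_Icc_self).aestronglyMeasurable measurableSet_Ioo) C ?_
  filter_upwards [ae_restrict_mem measurableSet_Ioo] with x hx using hC x (Ioo_subset_Icc_self hx)

/-- The kernel `s ↦ 1_{s ≤ x} - x` of `L²(0,1)`. The inner product of the kernels of `x` and `y` is
`min x y - x y`, the Green function of `-d²/dx²` under Dirichlet conditions and the covariance of
the Brownian bridge. -/
noncomputable def bridgeKernel (x : ℝ) : L2 :=
  indicatorConstLp 2 measurableSet_Iic (measure_ne_top unitMeasure (Iic x)) 1 -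
    (x : ℂ) • indicatorConstLp 2 .univ (measure_ne_top unitMeasure univ) 1

lemma inner_bridgeKernel (x : ℝ) (f : L2) : (inner ℂ (bridgeKernel x) f : ℂ) =
    ∫ s in Iic x, f s ∂unitMeasure - x * ∫ s, f s ∂unitMeasure := by
  rw [bridgeKernel, inner_sub_left, inner_smul_left, L2.inner_indicatorConstLp_one,
    L2.inner_indicatorConstLp_one, setIntegral_univ, Complex.conj_ofReal]

lemma norm_indicatorConstLp_one_le {s : Set ℝ} (hs : MeasurableSet s) :
    ‖(indicatorConstLp 2 hs (measure_ne_top unitMeasure s) 1 : L2)‖ ≤ 1 := by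
  refine norm_indicatorConstLp_le.trans ?_
  rw [norm_one, one_mul]
  exact Real.rpow_le_one measureReal_nonneg measureReal_le_one (by positivity)

lemma norm_bridgeKernel_le {x : ℝ} (hx : x ∈ Icc 0 1) : ‖bridgeKernel x‖ ≤ 2 := by
  have hnorm : ‖(x : ℂ)‖ ≤ 1 := by
    rw [Complex.norm_real, Real.norm_of_nonneg hx.1]
    exact hx.2
  calc ‖bridgeKernel x‖ ≤ 1 + ‖(x : ℂ)‖ * 1 := by
        refine (norm_sub_le _ _).trans ?_
        rw [norm_smul]
        gcongr <;> exact norm_indicatorConstLp_one_le _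
    _ ≤ 2 := by linarith

lemma norm_inner_bridgeKernel_le (f : L2) :
    ∀ᵐ x ∂unitMeasure, ‖(inner ℂ (bridgeKernel x) f : ℂ)‖ ≤ 2 * ‖f‖ := by
  filter_upwards [ae_restrict_mem measurableSet_Ioo] with x hx
  refine (norm_inner_le_norm _ _).trans ?_
  gcongr
  exact norm_bridgeKernel_le (Ioo_subset_Icc_self hx)

lemma continuousOn_inner_bridgeKernel (f : L2) :
    ContinuousOn (fun x => (inner ℂ (bridgeKernel x) f : ℂ)) (Icc 0 1) := by
  have hprim : ContinuousOn (fun x => ∫ s in Iic x, f s ∂unitMeasure) (Icc 0 1) := by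
    refine ContinuousOn.congr ?_ fun x hx => setIntegral_Iic_unitMeasure hx f
    have hint : IntegrableOn f (uIcc 0 1) := by
      rw [uIcc_of_le zero_le_one, integrableOn_Icc_iff_integrableOn_Ioo]
      exact integrable_L2 f
    rw [← uIcc_of_le zero_le_one]
    exact intervalIntegral.continuousOn_primitive_interval hint
  simp only [inner_bridgeKernel]
  fun_prop

lemma inner_bridgeKernel_zero (f : L2) : (inner ℂ (bridgeKernel 0) f : ℂ) = 0 := by
  rw [inner_bridgeKernel, setIntegral_Iic_unitMeasure (left_mem_Icc.mpr zero_le_one)]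
  simp

lemma inner_bridgeKernel_one (f : L2) : (inner ℂ (bridgeKernel 1) f : ℂ) = 0 := by
  rw [inner_bridgeKernel, setIntegral_Iic_unitMeasure (right_mem_Icc.mpr zero_le_one),
    integral_unitMeasure]
  simp

lemma memLp_inner_bridgeKernel (f : L2) :
    MemLp (fun x => (inner ℂ (bridgeKernel x) f : ℂ)) 2 unitMeasure :=
  memLp_unitMeasure (continuousOn_inner_bridgeKernel f) 2

/-- The operator taking `f` to `x ↦ ∫₀ˣ f - x ∫₀¹ f`, the primitive of `f` minus its mean that
vanishes at both end points. -/
noncomputable def bridgeOperator : L2 →L[ℂ] L2 :=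
  LinearMap.mkContinuous
    { toFun := fun f => (memLp_inner_bridgeKernel f).toLp
      map_add' := fun f g => by simp only [inner_add_right]; rfl
      map_smul' := fun c f => by simp only [inner_smul_right]; rfl } 2 fun f => by
    refine (Lp.norm_le_of_ae_bound (C := 2 * ‖f‖) (by positivity) ?_).trans_eq ?_
    · filter_upwards [(memLp_inner_bridgeKernel f).coeFn_toLp, norm_inner_bridgeKernel_le f]
        with x hx hle
      exact hx ▸ hle
    · simp [measureUnivNNReal]

lemma coeFn_bridgeOperator (f : L2) :
    bridgeOperator f =ᵐ[unitMeasure] fun x => (inner ℂ (bridgeKernel x) f : ℂ) :=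
  (memLp_inner_bridgeKernel f).coeFn_toLp

lemma vanishesAtBoundary_bridgeOperator (f : L2) : VanishesAtBoundary (bridgeOperator f) :=
  ⟨_, continuousOn_inner_bridgeKernel f, (coeFn_bridgeOperator f).symm, inner_bridgeKernel_zero f,
    inner_bridgeKernel_one f⟩

lemma inner_bridgeKernel_eq_setIntegral {x : ℝ} (hx : x ∈ Icc 0 1) (f : L2) :
    (inner ℂ (bridgeKernel x) f : ℂ) =
      ∫ s in Iic x, (f s - ∫ r, f r ∂unitMeasure) ∂unitMeasure := by
  rw [inner_bridgeKernel, integral_sub (integrable_L2 f).integrableOn integrableOn_const,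
    setIntegral_Iic_unitMeasure hx fun _ => ∫ r, f r ∂unitMeasure, intervalIntegral.integral_const,
    sub_zero, Complex.real_smul]

lemma intervalIntegral_deriv_eq_sub {φ : ℝ → ℂ} (hφ : ContDiff ℝ 1 φ) (x y : ℝ) :
    ∫ s in x..y, deriv φ s = φ y - φ x :=
  intervalIntegral.integral_deriv_eq_sub (fun _ _ => hφ.differentiable_one _)
    (hφ.continuous_deriv_one.intervalIntegrable _ _)

lemma integral_bridgeOperator_mul_deriv (f : L2) {φ : ℝ → ℂ} (hφ : ContDiff ℝ 1 φ) :
    ∫ x, bridgeOperator f x * deriv φ x ∂unitMeasure =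
      (∫ x, f x ∂unitMeasure) * (∫ x, φ x ∂unitMeasure) - ∫ x, f x * φ x ∂unitMeasure := by
  set c := ∫ x, f x ∂unitMeasure with hc
  have hφi := (memLp_unitMeasure hφ.continuous.continuousOn 1).integrable le_rfl
  have hφ'i := (memLp_unitMeasure hφ.continuous_deriv_one.continuousOn 1).integrable le_rfl
  have hfφi : Integrable (fun x => f x * φ x) unitMeasure :=
    (Lp.memLp f).integrable_mul (memLp_unitMeasure hφ.continuous.continuousOn 2)
  have hfi : Integrable (fun x => f x - c) unitMeasure :=
    (integrable_L2 f).sub (integrable_const c)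
  have hlin : Integrable (fun x => (f x - c) * φ 1 + c * φ x) unitMeasure :=
    (hfi.mul_const _).add (hφi.const_mul c)
  calc ∫ x, bridgeOperator f x * deriv φ x ∂unitMeasure
      = ∫ x, (∫ s in Iic x, (f s - c) ∂unitMeasure) * deriv φ x ∂unitMeasure := by
        refine integral_congr_ae ?_
        filter_upwards [coeFn_bridgeOperator f, ae_restrict_mem measurableSet_Ioo] with x hx hmem
        rw [hx, inner_bridgeKernel_eq_setIntegral (Ioo_subset_Icc_self hmem)]
    _ = ∫ s, (f s - c) * ∫ x in Ici s, deriv φ x ∂unitMeasure ∂unitMeasure :=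
        integral_setIntegral_Iic_mul hfi hφ'i
    _ = ∫ s, ((f s - c) * φ 1 + c * φ s - f s * φ s) ∂unitMeasure := by
        refine integral_congr_ae ?_
        filter_upwards [ae_restrict_mem measurableSet_Ioo] with s hmem
        rw [setIntegral_Ici_unitMeasure (Ioo_subset_Icc_self hmem),
          intervalIntegral_deriv_eq_sub hφ]
        ring
    _ = c * (∫ x, φ x ∂unitMeasure) - ∫ x, f x * φ x ∂unitMeasure := by
        rw [integral_sub hlin hfφi, integral_add (hfi.mul_const _) (hφi.const_mul c),
          integral_mul_const, integral_const_mul, integral_sub (integrable_L2 f)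
          (integrable_const c), integral_const, probReal_univ, one_smul, ← hc, sub_self, zero_mul,
          zero_add]

lemma bridgeOperator_ae_eq_of_ae_eq_deriv {f : L2} {φ : ℝ → ℂ} (hφ : ContDiff ℝ 1 φ)
    (h₀ : φ 0 = 0) (h₁ : φ 1 = 0) (hf : f =ᵐ[unitMeasure] deriv φ) :
    bridgeOperator f =ᵐ[unitMeasure] φ := by
  have hprim : ∀ x, ∫ s in 0..x, deriv φ s = φ x := fun x => by
    rw [intervalIntegral_deriv_eq_sub hφ, h₀, sub_zero]
  filter_upwards [coeFn_bridgeOperator f, ae_restrict_mem measurableSet_Ioo] with x hx hmem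
  rw [hx, inner_bridgeKernel, integral_congr_ae hf, integral_congr_ae (ae_restrict_of_ae hf),
    integral_unitMeasure, setIntegral_Iic_unitMeasure (Ioo_subset_Icc_self hmem), hprim, hprim, h₁,
    mul_zero, sub_zero]

/-- The inverse of `-d²/dx²` under Dirichlet conditions. In this form it is positive at sight: the
kernel of `bridgeOperator ∘L bridgeOperator.adjoint` is the Green function `min x y - x y`. -/
noncomputable def dirichletGreen : L2 →L[ℂ] L2 :=
  bridgeOperator ∘L bridgeOperator.adjoint

lemma isPositive_dirichletGreen : dirichletGreen.IsPositive :=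
  ContinuousLinearMap.isPositive_self_comp_adjoint bridgeOperator

lemma integral_adjoint_bridgeOperator_mul_deriv (g : L2) {φ : ℝ → ℂ} (hφ : ContDiff ℝ 1 φ)
    (h₀ : φ 0 = 0) (h₁ : φ 1 = 0) :
    ∫ x, bridgeOperator.adjoint g x * deriv φ x ∂unitMeasure = ∫ x, g x * φ x ∂unitMeasure := by
  have hstar : ContDiff ℝ 1 (fun x => star (φ x)) := Complex.conjCLE.contDiff.comp hφ
  have hmem := memLp_unitMeasure hstar.continuous_deriv_one.continuousOn 2
  have hbridge := bridgeOperator_ae_eq_of_ae_eq_deriv hstar (by simp [h₀]) (by simp [h₁])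
    hmem.coeFn_toLp
  calc ∫ x, bridgeOperator.adjoint g x * deriv φ x ∂unitMeasure
      = inner ℂ hmem.toLp (bridgeOperator.adjoint g) := by
        refine integral_congr_ae ?_
        filter_upwards [hmem.coeFn_toLp] with x hx
        rw [hx, deriv.star, RCLike.inner_apply, starRingEnd_apply, star_star]
    _ = inner ℂ (bridgeOperator hmem.toLp) g := bridgeOperator.adjoint_inner_right _ _
    _ = ∫ x, g x * φ x ∂unitMeasure := by
        refine integral_congr_ae ?_
        filter_upwards [hbridge] with x hx
        rw [hx, RCLike.inner_apply, starRingEnd_apply, star_star]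

lemma isWeakSecondDeriv_dirichletGreen (g : L2) : IsWeakSecondDeriv (dirichletGreen g) (-g) := by
  intro φ hφ _ hsupp
  have hφ₁ : ContDiff ℝ 1 φ := hφ.of_le (by simp)
  have hφ'₁ : ContDiff ℝ 1 (deriv φ) := (contDiff_infty_iff_deriv.mp hφ).2.of_le (by simp)
  have h₀ : φ 0 = 0 := image_eq_zero_of_notMem_tsupport fun h => (hsupp h).1.false
  have h₁ : φ 1 = 0 := image_eq_zero_of_notMem_tsupport fun h => (hsupp h).2.false
  calc ∫ x, dirichletGreen g x * deriv (deriv φ) x ∂unitMeasure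
      = -∫ x, bridgeOperator.adjoint g x * deriv φ x ∂unitMeasure := by
        rw [dirichletGreen, ContinuousLinearMap.comp_apply,
          integral_bridgeOperator_mul_deriv _ hφ'₁, integral_unitMeasure (deriv φ),
          intervalIntegral_deriv_eq_sub hφ₁, h₀, h₁, sub_zero, mul_zero, zero_sub]
    _ = -∫ x, g x * φ x ∂unitMeasure := by
        rw [integral_adjoint_bridgeOperator_mul_deriv g hφ₁ h₀ h₁]
    _ = ∫ x, (-g : L2) x * φ x ∂unitMeasure := by
        rw [← integral_neg]
        refine integral_congr_ae ?_
        filter_upwards [Lp.coeFn_neg g] with x hx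
        rw [hx, Pi.neg_apply, neg_mul]

lemma slGraph_dirichletGreen (q : Linf) (g : L2) :
    SLGraph q (dirichletGreen g) (g + q • dirichletGreen g) :=
  ⟨vanishesAtBoundary_bridgeOperator _, -g, isWeakSecondDeriv_dirichletGreen g, by rw [neg_neg]⟩

lemma hasDerivWithinAt_intervalIntegral {F : Type*} [NormedAddCommGroup F] [NormedSpace ℝ F]
    [CompleteSpace F] {f : ℝ → F} {a b t : ℝ} (hf : ContinuousOn f (Icc a b)) (ht : t ∈ Icc a b) :
    HasDerivWithinAt (fun τ => ∫ s in a..τ, f s) (f t) (Icc a b) t := by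
  have : Fact (t ∈ Icc a b) := ⟨ht⟩
  exact intervalIntegral.integral_hasDerivWithinAt_right
    ((hf.mono (Icc_subset_Icc_right ht.2)).intervalIntegrable_of_Icc ht.1)
    (hf.stronglyMeasurableAtFilter_nhdsWithin measurableSet_Icc t) (hf t ht)

section Integrated

variable {T : ℝ} {q a b : Linf} {u₀ u₁ : L2} {u : ℝ → L2}

lemma IsSolution.apply_zero (hu : IsSolution T q a b u₀ u₁ u) : u 0 = u₀ := by
  obtain ⟨-, -, -, h, -⟩ := hu
  exact h

lemma IsSolution.continuousOn (hu : IsSolution T q a b u₀ u₁ u) : ContinuousOn u (Icc 0 T) := by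
  obtain ⟨v, w, hspace, -⟩ := hu
  exact fun t ht => (hspace.hasDeriv t ht).continuousWithinAt

lemma IsSolution.hasDerivWithinAt_primitive (hu : IsSolution T q a b u₀ u₁ u) {t : ℝ}
    (ht : t ∈ Icc 0 T) : HasDerivWithinAt (fun τ => ∫ s in 0..τ, u s) (u t) (Icc 0 T) t :=
  hasDerivWithinAt_intervalIntegral hu.continuousOn ht

lemma IsSolution.exists_velocity_inner_eq (hu : IsSolution T q a b u₀ u₁ u) :
    ∃ v : ℝ → L2, (∀ t ∈ Icc 0 T, HasDerivWithinAt u (v t) (Icc 0 T) t) ∧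
      ContinuousOn v (Icc 0 T) ∧ ∀ φ ψ, SLGraph q φ ψ → ∀ t ∈ Icc 0 T,
        (inner ℂ φ (v t + a • (∫ s in 0..t, u s) + b • u t) + inner ℂ ψ (∫ s in 0..t, u s) : ℂ) =
          inner ℂ φ (u₁ + b • u₀) := by
  have hU := fun t => hu.hasDerivWithinAt_primitive (t := t)
  obtain ⟨v, w, hspace, hu0, hv0, -, heq⟩ := hu
  refine ⟨v, hspace.hasDeriv, hspace.continuousOn_deriv, fun φ ψ hφψ t ht => ?_⟩
  have hinner : ∀ (χ : L2) {f : ℝ → L2} {f' : L2} {τ : ℝ}, HasDerivWithinAt f f' (Icc 0 T) τ →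
      HasDerivWithinAt (fun r => (inner ℂ χ (f r) : ℂ)) (inner ℂ χ f') (Icc 0 T) τ :=
    fun χ _ _ _ h => ((innerSL ℂ χ).restrictScalars ℝ).hasFDerivAt.comp_hasDerivWithinAt _ h
  have hderiv : ∀ τ ∈ Icc 0 T, HasDerivWithinAt (fun τ =>
      (inner ℂ φ (v τ) + inner ℂ φ (a • (∫ s in 0..τ, u s) + b • u τ : L2)
        + inner ℂ ψ (∫ s in 0..τ, u s) : ℂ)) 0 (Icc 0 T) τ := by
    intro τ hτ
    refine (((heq φ ψ hφψ τ hτ).add (hinner φ ((hasDerivWithinAt_Linf_smul a (hU τ hτ)).add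
      (hasDerivWithinAt_Linf_smul b (hspace.hasDeriv τ hτ))))).add
        (hinner ψ (hU τ hτ))).congr_deriv ?_
    ring
  have hconst := constant_of_has_deriv_right_zero (fun τ hτ => (hderiv τ hτ).continuousWithinAt)
    (fun τ hτ => (hderiv τ (Ico_subset_Icc_self hτ)).mono_of_mem_nhdsWithin
      (Icc_mem_nhdsGE_of_mem hτ)) t ht
  simpa only [intervalIntegral.integral_same, Lp.smul_zero, inner_zero_right, hu0, hv0, zero_add,
    add_zero, inner_add_right, add_assoc] using hconst

/-- The right-hand side of the wave equation integrated over `[0, t]`, with the bounded coefficients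
moved to the right: `-U'' = u₁ - v - p U - b (u - u₀)`, where `U` is the integral of `u` over
`[0, t]`, `u` and `v` are displacement and velocity at time `t`, and `p` is `q + a`. -/
noncomputable def integratedSource (p b : Linf) (u₀ u₁ U u v : L2) : L2 :=
  u₁ - v - p • U - b • (u - u₀)

lemma IsSolution.exists_velocity_primitive_eq (hu : IsSolution T q a b u₀ u₁ u) :
    ∃ v : ℝ → L2, (∀ t ∈ Icc 0 T, HasDerivWithinAt u (v t) (Icc 0 T) t) ∧
      ContinuousOn v (Icc 0 T) ∧ ∀ t ∈ Icc 0 T,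
        dirichletGreen (integratedSource (q + a) b u₀ u₁ (∫ s in 0..t, u s) (u t) (v t)) =
          ∫ s in 0..t, u s := by
  obtain ⟨v, hv, hvc, hweak⟩ := hu.exists_velocity_inner_eq
  refine ⟨v, hv, hvc, fun t ht => ext_inner_left ℂ fun g => ?_⟩
  have h := hweak _ _ (slGraph_dirichletGreen q g) t ht
  rw [← isPositive_dirichletGreen.inner_left_eq_inner_right]
  simp only [integratedSource, inner_add_left, ← inner_smul_comm, inner_add_right, Lp.smul_add,
    Lp.add_smul, sub_eq_add_neg, Lp.smul_neg, inner_neg_right] at h ⊢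
  linear_combination -h

end Integrated

lemma norm_integratedSource_sub_le (p b p' b' : Linf) (u₀ u₁ U u v u₀' u₁' U' u' v' : L2) :
    ‖(v' - v) + (integratedSource p' b' u₀' u₁' U' u' v' - integratedSource p b u₀ u₁ U u v)‖ ≤
      ‖u₁' - u₁‖ + (‖p'‖ * ‖U' - U‖ + ‖p' - p‖ * ‖U‖) +
        (‖b'‖ * (‖u' - u‖ + ‖u₀' - u₀‖) + ‖b' - b‖ * ‖u - u₀‖) := by
  have hsplit : (v' - v) +
      (integratedSource p' b' u₀' u₁' U' u' v' - integratedSource p b u₀ u₁ U u v) =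
        (u₁' - u₁) - (p' • U' - p • U) - (b' • (u' - u₀') - b • (u - u₀)) := by
    unfold integratedSource
    abel
  have hdamp : ‖(u' - u₀') - (u - u₀)‖ ≤ ‖u' - u‖ + ‖u₀' - u₀‖ := by
    rw [sub_sub_sub_comm]
    exact norm_sub_le _ _
  rw [hsplit]
  refine (norm_sub_le _ _).trans (add_le_add ((norm_sub_le _ _).trans ?_) ?_)
  · gcongr
    exact norm_smul_sub_smul_le p p' U U'
  · refine (norm_smul_sub_smul_le b b' _ _).trans ?_
    gcongr

lemma continuousOn_integratedSource (p b : Linf) (u₀ u₁ : L2) {U u v : ℝ → L2} {s : Set ℝ}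
    (hU : ContinuousOn U s) (hu : ContinuousOn u s) (hv : ContinuousOn v s) :
    ContinuousOn (fun t => integratedSource p b u₀ u₁ (U t) (u t) (v t)) s :=
  ((continuousOn_const.sub hv).sub ((continuous_Linf_smul p).comp_continuousOn hU)).sub
    ((continuous_Linf_smul b).comp_continuousOn (hu.sub continuousOn_const))

theorem IsSolution.norm_sub_sq_le_gronwallBound {T R M : ℝ} {q a b q' a' b' : Linf}
    {u₀ u₁ u₀' u₁' : L2} {u u' : ℝ → L2} (hu : IsSolution T q a b u₀ u₁ u)
    (hu' : IsSolution T q' a' b' u₀' u₁' u') (hqa : ‖q' + a'‖ ≤ M) (hb : ‖b'‖ ≤ M)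
    (hR : ∀ t ∈ Icc 0 T, ‖∫ s in 0..t, u s‖ ≤ R) (hR₀ : ∀ t ∈ Icc 0 T, ‖u t - u₀‖ ≤ R) {t : ℝ}
    (ht : t ∈ Icc 0 T) :
    ‖u' t - u t‖ ^ 2 ≤ gronwallBound (‖u₀' - u₀‖ ^ 2) (3 * M + 2)
      ((‖u₁' - u₁‖ + (‖(q' + a') - (q + a)‖ + ‖b' - b‖) * R + M * ‖u₀' - u₀‖) ^ 2) t := by
  obtain ⟨v, hv, hvc, hgreen⟩ := hu.exists_velocity_primitive_eq
  obtain ⟨v', hv', hvc', hgreen'⟩ := hu'.exists_velocity_primitive_eq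
  have hU := fun τ => hu.hasDerivWithinAt_primitive (t := τ)
  have hU' := fun τ => hu'.hasDerivWithinAt_primitive (t := τ)
  set h : ℝ → L2 := fun τ =>
    integratedSource (q' + a') b' u₀' u₁' (∫ s in 0..τ, u' s) (u' τ) (v' τ) -
      integratedSource (q + a) b u₀ u₁ (∫ s in 0..τ, u s) (u τ) (v τ) with h_def
  have hcont : ContinuousOn h (Icc 0 T) :=
    (continuousOn_integratedSource _ _ _ _ (fun τ hτ => (hU' τ hτ).continuousWithinAt)
      hu'.continuousOn hvc').sub (continuousOn_integratedSource _ _ _ _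
        (fun τ hτ => (hU τ hτ).continuousWithinAt) hu.continuousOn hvc)
  have hSh : ∀ τ ∈ Icc 0 T,
      dirichletGreen (h τ) = (∫ s in 0..τ, u' s) - ∫ s in 0..τ, u s := fun τ hτ => by
    rw [h_def, map_sub, hgreen' τ hτ, hgreen τ hτ]
  have hzero : dirichletGreen (h 0) = 0 := by
    rw [hSh 0 ⟨le_rfl, ht.1.trans ht.2⟩]
    simp
  have hbound := norm_sq_le_gronwallBound isPositive_dirichletGreen ((norm_nonneg _).trans hqa)
    hcont (d := fun τ => u' τ - u τ) (e := fun τ => v' τ - v τ)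
    (fun τ hτ => ((hU' τ hτ).sub (hU τ hτ)).congr hSh (hSh τ hτ))
    (fun τ hτ => (hv' τ hτ).sub (hv τ hτ)) hzero (M := M)
    (g := ‖u₁' - u₁‖ + (‖(q' + a') - (q + a)‖ + ‖b' - b‖) * R + M * ‖u₀' - u₀‖) ?_ ht
  · simpa only [hu.apply_zero, hu'.apply_zero, sub_zero] using hbound
  intro τ hτ
  rw [hSh τ hτ]
  calc ‖(v' τ - v τ) + h τ‖ ≤ _ := norm_integratedSource_sub_le ..
    _ ≤ ‖u₁' - u₁‖ + (M * ‖(∫ s in 0..τ, u' s) - ∫ s in 0..τ, u s‖ +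
          ‖(q' + a') - (q + a)‖ * R) +
        (M * (‖u' τ - u τ‖ + ‖u₀' - u₀‖) + ‖b' - b‖ * R) := by
      gcongr
      exacts [hR τ hτ, hR₀ τ hτ]
    _ = _ := by ring

lemma tendsto_gronwallBound_zero {ι : Type*} {l : Filter ι} {δ ε : ι → ℝ} (K x : ℝ)
    (hδ : Tendsto δ l (𝓝 0)) (hε : Tendsto ε l (𝓝 0)) :
    Tendsto (fun i => gronwallBound (δ i) K (ε i) x) l (𝓝 0) := by
  have hlim : Tendsto (fun i => δ i * Real.exp (K * x) + ε i * gronwallBound 0 K 1 x) l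
      (𝓝 (0 * Real.exp (K * x) + 0 * gronwallBound 0 K 1 x)) :=
    (hδ.mul_const _).add (hε.mul_const _)
  rw [zero_mul, zero_mul, add_zero] at hlim
  refine hlim.congr fun i => ?_
  rcases eq_or_ne K 0 with rfl | hK
  · simp [gronwallBound_K0]
  · simp only [gronwallBound_of_K_ne_0 hK]
    ring

end SturmLiouvilleWave

theorem mainTheorem10_general {ι : Type*} {l : Filter ι} {T : ℝ}
    {q a b : SturmLiouvilleWave.Linf} {u₀ u₁ : SturmLiouvilleWave.L2}
    {u : ℝ → SturmLiouvilleWave.L2} (hu : SturmLiouvilleWave.IsSolution T q a b u₀ u₁ u)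
    {q' a' b' : ι → SturmLiouvilleWave.Linf} {u₀' u₁' : ι → SturmLiouvilleWave.L2}
    {u' : ι → ℝ → SturmLiouvilleWave.L2}
    (hq : Tendsto q' l (𝓝 q)) (ha : Tendsto a' l (𝓝 a)) (hb : Tendsto b' l (𝓝 b))
    (hu₀ : Tendsto u₀' l (𝓝 u₀)) (hu₁ : Tendsto u₁' l (𝓝 u₁))
    (hu' : ∀ᶠ i in l,
      SturmLiouvilleWave.IsSolution T (q' i) (a' i) (b' i) (u₀' i) (u₁' i) (u' i)) :
    TendstoUniformlyOn u' u l (Icc 0 T) := by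
  obtain ⟨R, hR⟩ := isCompact_Icc.exists_bound_of_continuousOn fun t ht =>
    (hu.hasDerivWithinAt_primitive ht).continuousWithinAt
  obtain ⟨R₀, hR₀⟩ := isCompact_Icc.exists_bound_of_continuousOn
    (hu.continuousOn.sub (continuousOn_const (c := u₀)))
  set M := max ‖q + a‖ ‖b‖ + 1
  have hqa : Tendsto (fun i => q' i + a' i) l (𝓝 (q + a)) := hq.add ha
  have hqaM : ∀ᶠ i in l, ‖q' i + a' i‖ ≤ M :=
    hqa.norm.eventually_le_const ((le_max_left _ _).trans_lt (lt_add_one _))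
  have hbM : ∀ᶠ i in l, ‖b' i‖ ≤ M :=
    hb.norm.eventually_le_const ((le_max_right _ _).trans_lt (lt_add_one _))
  rw [tendsto_iff_norm_sub_tendsto_zero] at hqa hb hu₀ hu₁
  have hg : Tendsto (fun i => ‖u₁' i - u₁‖ +
      (‖(q' i + a' i) - (q + a)‖ + ‖b' i - b‖) * max R R₀ + M * ‖u₀' i - u₀‖) l (𝓝 0) := by
    simpa using (hu₁.add ((hqa.add hb).mul_const (max R R₀))).add (hu₀.const_mul M)
  have hbound := SturmLiouvilleWave.tendsto_gronwallBound_zero (3 * M + 2) T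
    (by simpa using hu₀.pow 2) (by simpa using hg.pow 2)
  rw [Metric.tendstoUniformlyOn_iff]
  intro ε hε
  filter_upwards [hu', hqaM, hbM, hbound.eventually_lt_const (pow_pos hε 2)]
    with i hi hqai hbi hlt t ht
  rw [dist_comm, dist_eq_norm]
  refine lt_of_pow_lt_pow_left₀ 2 hε.le (lt_of_le_of_lt ?_ hlt)
  exact (hu.norm_sub_sq_le_gronwallBound hi hqai hbi (fun t ht => (hR t ht).trans (le_max_left _ _))
    (fun t ht => (hR₀ t ht).trans (le_max_right _ _)) ht).trans
    (gronwallBound_mono (by positivity) (by positivity) (by positivity) ht.2)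

theorem mainTheorem10 (T : ℝ) (hT : 0 < T)
    (q a b : SturmLiouvilleWave.Linf) (ha : 0 ≤ a) (hb : 0 ≤ b)
    (u₀ u₁ : SturmLiouvilleWave.L2)
    (hu₀ : ∃ g, SturmLiouvilleWave.IsWeakSecondDeriv u₀ g)
    (u : ℝ → SturmLiouvilleWave.L2)
    (hu : SturmLiouvilleWave.IsSolution T q a b u₀ u₁ u)
    (qε aε bε : ℝ → SturmLiouvilleWave.Linf)
    (u₀ε u₁ε : ℝ → SturmLiouvilleWave.L2)
    (haε : Tendsto (fun ε => ‖aε ε - a‖) (𝓝[>] 0) (𝓝 0))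
    (hbε : Tendsto (fun ε => ‖bε ε - b‖) (𝓝[>] 0) (𝓝 0))
    (hqε : Tendsto (fun ε => ‖qε ε - q‖) (𝓝[>] 0) (𝓝 0))
    (hu₀ε : Tendsto (fun ε => ‖u₀ε ε - u₀‖) (𝓝[>] 0) (𝓝 0))
    (hu₁ε : Tendsto (fun ε => ‖u₁ε ε - u₁‖) (𝓝[>] 0) (𝓝 0))
    (uε : ℝ → ℝ → SturmLiouvilleWave.L2)
    (huε : SturmLiouvilleWave.IsVeryWeakSolution T qε aε bε u₀ε u₁ε uε) :
    TendstoUniformlyOn uε u (𝓝[>] 0) (Icc 0 T) := by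
  exact mainTheorem10_general hu (tendsto_iff_norm_sub_tendsto_zero.mpr hqε)
    (tendsto_iff_norm_sub_tendsto_zero.mpr haε) (tendsto_iff_norm_sub_tendsto_zero.mpr hbε)
    (tendsto_iff_norm_sub_tendsto_zero.mpr hu₀ε) (tendsto_iff_norm_sub_tendsto_zero.mpr hu₁ε)
    (eventually_of_mem (Ioc_mem_nhdsGT zero_lt_one) huε.solves)
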